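/- All C*-algebras are complex and unital (the zero algebra is allowed) and all $*$-homomorphisms are unital. **Definitions.** A *noncommutative continuous function* $\varphi$ in the variables $x_1,\dots,x_n$ is an element of the completion of the algebra of noncommutative $*$-polynomials in $x_1,\dots,x_n$ with respect to the seminorms $\|p\|_R=\sup\{\|p(T_1,\dots,T_n)\| : T_i \text{ in a C*-algebra},\ \|T_i\|\le R\}$, $R>0$; it can be evaluated at every $n$-tuple of elements of a C*-algebra. It is *null-bounded* if there is $r>0$ such that $\varphi(T_1,\dots,T_n)=0$ implies $\|T_i\|\le r$ for all $i$. For null-bounded $\varphi$, $C^*(x_1,\dots,x_n\mid\varphi)$ denotes the universal C*-algebra with generators $x_1,\dots,x_n$ and the single relation $\varphi(x_1,\dots,x_n)=0$. A C*-algebra $\mathcal A$ is *semiprojective* if for every C*-algebra $\mathcal B$, every increasing sequence $(\mathcal J_n)$ of closed two-sided ideals of $\mathcal B$ and every $*$-homomorphism $\pi:\mathcal A\to\mathcal B/\overline{\bigcup_n\mathcal J_n}$ there are $N$ and a $*$-homomorphism $\pi_N:\mathcal A\to\mathcal B/\mathcal J_N$ such that $\pi$ is the composition of $\pi_N$ with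 the natural map $\mathcal B/\mathcal J_N\to\mathcal B/\overline{\bigcup_n\mathcal J_n}$. It is *weakly semiprojective* if for every sequence $(\mathcal B_n)$ of C*-algebras and every $*$-homomorphism $\pi:\mathcal A\to\prod_n\mathcal B_n/\bigoplus_n\mathcal B_n$ (bounded sequences modulo sequences that tend to $0$ in norm) there are functions $\pi_n:\mathcal A\to\mathcal B_n$ and a number $N$ such that $\pi_n$ is a $*$-homomorphism for all $n\ge N$ and, for every $a\in\mathcal A$, the sequence $(\pi_n(a))_n$ is bounded and $\pi(a)=[(\pi_n(a))_n]$. **Theorem.** (1) Let $\varphi,\psi$ be null-bounded noncommutative continuous functions in $n$ variables such that the generators $P_1,\dots,P_n$ of $C^*(P_1,\dots,P_n\mid\varphi)$ and the generators $Q_1,\dots,Q_n$ of $C^*(Q_1,\dots,Q_n\mid\psi)$ are projections. Define the noncommutative continuous function $$\Phi(V_1,\dots,V_n)=\varphi(V_1^*V_1,\dots,V_n^*V_n)^*\,\varphi(V_1^*V_1,\dots,V_n^*V_n)+\psi(V_1V_1^*,\dots,V_nV_n^*)^*\,\psi(V_1V_1^*,\dots,V_nV_n^*).$$ Then $\Phi$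 is null-bounded (so that $C^*(V_1,\dots,V_n\mid\Phi)$ exists). If $C^*(P_1,\dots,P_n\mid\varphi)$ and $C^*(Q_1,\dots,Q_n\mid\psi)$ are both semiprojective, then $C^*(V_1,\dots,V_n\mid\Phi)$ is semiprojective; if both are weakly semiprojective, then $C^*(V_1,\dots,V_n\mid\Phi)$ is weakly semiprojective. (2) Let $\phi$ be a null-bounded noncommutative continuous function in $2n$ variables such that the generators $P_1,\dots,P_n,Q_1,\dots,Q_n$ of $C^*(P_1,\dots,P_n,Q_1,\dots,Q_n\mid\phi)$ are projections. Define $$\Psi(V_1,\dots,V_n)=\phi(V_1^*V_1,\dots,V_n^*V_n,V_1V_1^*,\dots,V_nV_n^*)^*\,\phi(V_1^*V_1,\dots,V_n^*V_n,V_1V_1^*,\dots,V_nV_n^*).$$ Then $\Psi$ is null-bounded. If $C^*(P_1,\dots,P_n,Q_1,\dots,Q_n\mid\phi)$ is semiprojective, then $C^*(V_1,\dots,V_n\mid\Psi)$ is semiprojective; if it is weakly semiprojective, then $C^*(V_1,\dots,V_n\mid\Psi)$ is weakly semiprojective. -/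

import Mathlib

universe u

noncomputable section

open scoped ENNReal

/-! ### Noncommutative `*`-polynomials and noncommutative continuous functions -/

/-- Noncommutative `*`-polynomials in the variables `x i`, `i : ι`: the free unital complex algebra
on the symbols `x i` (`Sum.inl i`) and `(x i)^*` (`Sum.inr i`). -/
abbrev NCPoly (ι : Type) : Type := FreeAlgebra ℂ (ι ⊕ ι)

/-- Evaluation of a noncommutative `*`-polynomial at a tuple in a unital C*-algebra. -/
def NCPoly.eval {ι : Type} {B : Type u} [CStarAlgebra B] (T : ι → B) : NCPoly ι →ₐ[ℂ] B :=
  FreeAlgebra.lift ℂ (Sum.elim T (fun i => star (T i)))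

/-- A family of functions, one on the `ι`-tuples of each unital C*-algebra, that can be approximated
by noncommutative `*`-polynomials, uniformly over all `ι`-tuples of norm at most `R` in all unital
C*-algebras, for every `R`. -/
def IsNCContinuous {ι : Type} (f : ∀ (B : Type u) [CStarAlgebra B], (ι → B) → B) : Prop :=
  ∀ R ε : ℝ, 0 < ε → ∃ p : NCPoly ι, ∀ (B : Type u) [CStarAlgebra B] (T : ι → B),
    (∀ i, ‖T i‖ ≤ R) → ‖f B T - NCPoly.eval T p‖ ≤ ε

/-- A noncommutative continuous function in the variables `x i`, `i : ι`. These functions are the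
elements of the completion of the algebra of noncommutative `*`-polynomials with respect to the
seminorms `p ↦ sup {‖p(T)‖ : ‖T i‖ ≤ R for all i}`, `R > 0`; an element of that completion is
represented here by its functional calculus, that is by the locally uniform limit of
the polynomials on all tuples. -/
structure NCFun (ι : Type) : Type (u + 1) where
  toFun : ∀ (B : Type u) [CStarAlgebra B], (ι → B) → B
  isNCContinuous : IsNCContinuous toFun

/-- The value `φ(T)` of a noncommutative continuous function at a tuple `T`. -/
def NCFun.eval {ι : Type} (φ : NCFun.{u} ι) {B : Type u} [CStarAlgebra B] (T : ι → B) : B :=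
  φ.toFun B T

/-- `φ` is null-bounded: the tuples with `φ(T) = 0` are uniformly bounded. -/
def NCFun.NullBounded {ι : Type} (φ : NCFun.{u} ι) : Prop :=
  ∃ r : ℝ, 0 < r ∧ ∀ (B : Type u) [CStarAlgebra B] (T : ι → B), φ.eval T = 0 → ∀ i, ‖T i‖ ≤ r

section Operations

variable {ι κ : Type}

theorem CStarAlgebra.norm_one_le_one (B : Type u) [CStarAlgebra B] : ‖(1 : B)‖ ≤ 1 := by
  rcases subsingleton_or_nontrivial B with h | h
  · rw [Subsingleton.elim (1 : B) 0, norm_zero]; exact zero_le_one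
  · rw [CStarRing.norm_one]

@[simp] theorem NCPoly.eval_inl {B : Type u} [CStarAlgebra B] (T : ι → B) (i : ι) :
    NCPoly.eval T (FreeAlgebra.ι ℂ (Sum.inl i)) = T i := by simp [NCPoly.eval]

@[simp] theorem NCPoly.eval_inr {B : Type u} [CStarAlgebra B] (T : ι → B) (i : ι) :
    NCPoly.eval T (FreeAlgebra.ι ℂ (Sum.inr i)) = star (T i) := by simp [NCPoly.eval]

theorem NCPoly.exists_bound (p : NCPoly ι) (R : ℝ) :
    ∃ C : ℝ, 0 ≤ C ∧ ∀ (B : Type u) [CStarAlgebra B] (T : ι → B),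
      (∀ i, ‖T i‖ ≤ R) → ‖NCPoly.eval T p‖ ≤ C := by
  induction p using FreeAlgebra.induction with
  | grade0 r =>
    refine ⟨‖r‖, norm_nonneg _, fun B _ T _ => ?_⟩
    rw [AlgHom.commutes, Algebra.algebraMap_eq_smul_one, norm_smul]
    exact mul_le_of_le_one_right (norm_nonneg _) (CStarAlgebra.norm_one_le_one B)
  | grade1 x =>
    refine ⟨|R|, abs_nonneg _, fun B _ T hT => ?_⟩
    rcases x with i | i
    · rw [NCPoly.eval_inl]; exact (hT i).trans (le_abs_self R)
    · rw [NCPoly.eval_inr, norm_star]; exact (hT i).trans (le_abs_self R)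
  | mul a b ha hb =>
    obtain ⟨C, hC, h⟩ := ha
    obtain ⟨D, hD, k⟩ := hb
    refine ⟨C * D, mul_nonneg hC hD, fun B _ T hT => ?_⟩
    rw [map_mul]
    exact (norm_mul_le _ _).trans (mul_le_mul (h B T hT) (k B T hT) (norm_nonneg _) hC)
  | add a b ha hb =>
    obtain ⟨C, hC, h⟩ := ha
    obtain ⟨D, hD, k⟩ := hb
    refine ⟨C + D, add_nonneg hC hD, fun B _ T hT => ?_⟩
    rw [map_add]
    exact (norm_add_le _ _).trans (add_le_add (h B T hT) (k B T hT))

theorem NCPoly.exists_star (p : NCPoly ι) : ∃ q : NCPoly ι,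
    ∀ (B : Type u) [CStarAlgebra B] (T : ι → B), NCPoly.eval T q = star (NCPoly.eval T p) := by
  induction p using FreeAlgebra.induction with
  | grade0 r =>
    refine ⟨algebraMap ℂ _ (star r), fun B _ T => ?_⟩
    rw [AlgHom.commutes, AlgHom.commutes, algebraMap_star_comm]
  | grade1 x =>
    rcases x with i | i
    · exact ⟨FreeAlgebra.ι ℂ (Sum.inr i), fun B _ T => by simp⟩
    · exact ⟨FreeAlgebra.ι ℂ (Sum.inl i), fun B _ T => by simp⟩
  | mul a b ha hb =>
    obtain ⟨c, hc⟩ := ha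
    obtain ⟨d, hd⟩ := hb
    exact ⟨d * c, fun B _ T => by simp [hc, hd]⟩
  | add a b ha hb =>
    obtain ⟨c, hc⟩ := ha
    obtain ⟨d, hd⟩ := hb
    exact ⟨c + d, fun B _ T => by simp [hc, hd]⟩

theorem NCPoly.exists_subst (p : NCPoly κ) (q : κ → NCPoly ι) : ∃ r : NCPoly ι,
    ∀ (B : Type u) [CStarAlgebra B] (T : ι → B),
      NCPoly.eval T r = NCPoly.eval (fun j => NCPoly.eval T (q j)) p := by
  choose s hs using fun j => NCPoly.exists_star.{u} (q j)
  refine ⟨FreeAlgebra.lift ℂ (Sum.elim q s) p, fun B _ T => ?_⟩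
  have h : (NCPoly.eval T).comp (FreeAlgebra.lift ℂ (Sum.elim q s)) =
      NCPoly.eval (fun j => NCPoly.eval T (q j)) := by
    apply FreeAlgebra.hom_ext
    funext x
    rcases x with j | j <;> simp [hs]
  exact DFunLike.congr_fun h p

theorem IsNCContinuous.exists_bound {f : ∀ (B : Type u) [CStarAlgebra B], (ι → B) → B}
    (hf : IsNCContinuous f) (R : ℝ) :
    ∃ C : ℝ, 0 ≤ C ∧ ∀ (B : Type u) [CStarAlgebra B] (T : ι → B),
      (∀ i, ‖T i‖ ≤ R) → ‖f B T‖ ≤ C := by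
  obtain ⟨p, hp⟩ := hf R 1 one_pos
  obtain ⟨C, hC, h⟩ := NCPoly.exists_bound.{u} p R
  refine ⟨1 + C, by positivity, fun B _ T hT => ?_⟩
  calc ‖f B T‖ = ‖(f B T - NCPoly.eval T p) + NCPoly.eval T p‖ := by rw [sub_add_cancel]
    _ ≤ _ := (norm_add_le _ _).trans (add_le_add (hp B T hT) (h B T hT))

theorem IsNCContinuous.add {f g : ∀ (B : Type u) [CStarAlgebra B], (ι → B) → B}
    (hf : IsNCContinuous f) (hg : IsNCContinuous g) :
    IsNCContinuous (fun (B : Type u) _ T => f B T + g B T) := by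
  intro R ε hε
  obtain ⟨p, hp⟩ := hf R (ε / 2) (half_pos hε)
  obtain ⟨q, hq⟩ := hg R (ε / 2) (half_pos hε)
  refine ⟨p + q, fun B _ T hT => ?_⟩
  rw [map_add, add_sub_add_comm]
  refine (norm_add_le _ _).trans ?_
  linarith [hp B T hT, hq B T hT]

theorem IsNCContinuous.star {f : ∀ (B : Type u) [CStarAlgebra B], (ι → B) → B}
    (hf : IsNCContinuous f) : IsNCContinuous (fun (B : Type u) _ T => star (f B T)) := by
  intro R ε hε
  obtain ⟨p, hp⟩ := hf R ε hε
  obtain ⟨q, hq⟩ := NCPoly.exists_star.{u} p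
  refine ⟨q, fun B _ T hT => ?_⟩
  rw [hq, ← star_sub, norm_star]
  exact hp B T hT

theorem IsNCContinuous.mul {f g : ∀ (B : Type u) [CStarAlgebra B], (ι → B) → B}
    (hf : IsNCContinuous f) (hg : IsNCContinuous g) :
    IsNCContinuous (fun (B : Type u) _ T => f B T * g B T) := by
  intro R ε hε
  obtain ⟨D, hD, hgD⟩ := hg.exists_bound R
  obtain ⟨p, hp⟩ := hf R (ε / 2 / (D + 1)) (by positivity)
  obtain ⟨C, hC, hpC⟩ := NCPoly.exists_bound.{u} p R
  obtain ⟨q, hq⟩ := hg R (ε / 2 / (C + 1)) (by positivity)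
  refine ⟨p * q, fun B _ T hT => ?_⟩
  have e : f B T * g B T - NCPoly.eval T (p * q) =
      (f B T - NCPoly.eval T p) * g B T + NCPoly.eval T p * (g B T - NCPoly.eval T q) := by
    rw [map_mul]; noncomm_ring
  have h1 : ‖(f B T - NCPoly.eval T p) * g B T‖ ≤ ε / 2 := by
    refine (norm_mul_le _ _).trans ?_
    calc _ ≤ ε / 2 / (D + 1) * (D + 1) :=
          mul_le_mul (hp B T hT) ((hgD B T hT).trans (by linarith)) (norm_nonneg _) (by positivity)
      _ = ε / 2 := div_mul_cancel₀ _ (by positivity)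
  have h2 : ‖NCPoly.eval T p * (g B T - NCPoly.eval T q)‖ ≤ ε / 2 := by
    refine (norm_mul_le _ _).trans ?_
    calc _ ≤ (C + 1) * (ε / 2 / (C + 1)) :=
          mul_le_mul ((hpC B T hT).trans (by linarith)) (hq B T hT) (norm_nonneg _) (by positivity)
      _ = ε / 2 := mul_div_cancel₀ _ (by positivity)
  rw [e]
  refine (norm_add_le _ _).trans ?_
  linarith

theorem IsNCContinuous.subst [Finite κ] {f : ∀ (B : Type u) [CStarAlgebra B], (κ → B) → B}
    (hf : IsNCContinuous f) (q : κ → NCPoly ι) :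
    IsNCContinuous (fun (B : Type u) _ (T : ι → B) => f B (fun j => NCPoly.eval T (q j))) := by
  intro R ε hε
  choose C hC h using fun j => NCPoly.exists_bound.{u} (q j) R
  obtain ⟨S, hS⟩ := Set.finite_range C |>.bddAbove
  obtain ⟨p, hp⟩ := hf S ε hε
  obtain ⟨r, hr⟩ := NCPoly.exists_subst.{u} p q
  refine ⟨r, fun B _ T hT => ?_⟩
  rw [hr]
  exact hp B _ fun j => (h j B T hT).trans (hS ⟨j, rfl⟩)

end Operations

/-- `Φ(V) = φ(V₁^*V₁, …, Vₙ^*Vₙ)^* φ(V₁^*V₁, …, Vₙ^*Vₙ) + ψ(V₁V₁^*, …, VₙVₙ^*)^* ψ(V₁V₁^*, …, VₙVₙ^*)`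
as a noncommutative continuous function. -/
def NCFun.glue {n : ℕ} (φ ψ : NCFun.{u} (Fin n)) : NCFun.{u} (Fin n) where
  toFun _ _ V :=
    star (φ.eval fun i => star (V i) * V i) * φ.eval (fun i => star (V i) * V i) +
      star (ψ.eval fun i => V i * star (V i)) * ψ.eval (fun i => V i * star (V i))
  isNCContinuous := by
    have h1 := φ.isNCContinuous.subst fun i : Fin n =>
      (FreeAlgebra.ι ℂ (Sum.inr i) * FreeAlgebra.ι ℂ (Sum.inl i) : NCPoly (Fin n))
    have h2 := ψ.isNCContinuous.subst fun i : Fin n =>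
      (FreeAlgebra.ι ℂ (Sum.inl i) * FreeAlgebra.ι ℂ (Sum.inr i) : NCPoly (Fin n))
    simp only [map_mul, NCPoly.eval_inl, NCPoly.eval_inr] at h1 h2
    exact (h1.star.mul h1).add (h2.star.mul h2)

/-- `Ψ(V) = φ(V₁^*V₁, …, Vₙ^*Vₙ, V₁V₁^*, …, VₙVₙ^*)^* φ(V₁^*V₁, …, Vₙ^*Vₙ, V₁V₁^*, …, VₙVₙ^*)`
as a noncommutative continuous function. The `2n` variables of `φ` are indexed by
`Fin n ⊕ Fin n`. -/
def NCFun.glueJoint {n : ℕ} (φ : NCFun.{u} (Fin n ⊕ Fin n)) : NCFun.{u} (Fin n) where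
  toFun _ _ V :=
    star (φ.eval (Sum.elim (fun i => star (V i) * V i) (fun i => V i * star (V i)))) *
      φ.eval (Sum.elim (fun i => star (V i) * V i) (fun i => V i * star (V i)))
  isNCContinuous := by
    have h1 := φ.isNCContinuous.subst (Sum.elim
      (fun i => (FreeAlgebra.ι ℂ (Sum.inr i) * FreeAlgebra.ι ℂ (Sum.inl i) : NCPoly (Fin n)))
      (fun i => (FreeAlgebra.ι ℂ (Sum.inl i) * FreeAlgebra.ι ℂ (Sum.inr i) : NCPoly (Fin n))))
    have e : ∀ (B : Type u) [CStarAlgebra B] (V : Fin n → B),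
        (fun j => NCPoly.eval V (Sum.elim
          (fun i => (FreeAlgebra.ι ℂ (Sum.inr i) * FreeAlgebra.ι ℂ (Sum.inl i) : NCPoly (Fin n)))
          (fun i => (FreeAlgebra.ι ℂ (Sum.inl i) * FreeAlgebra.ι ℂ (Sum.inr i) : NCPoly (Fin n)))
          j)) =
        Sum.elim (fun i => star (V i) * V i) (fun i => V i * star (V i)) := by
      intro B _ V
      funext j
      rcases j with j | j <;> simp
    simp only [e] at h1
    exact h1.star.mul h1

/-! ### The universal unital C*-algebra `C*(x₁, …, xₙ | φ)` -/

section Universal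

variable {ι : Type}

/-- A solution of `φ(T) = 0` in a nonzero unital C*-algebra. -/
structure NCFun.Sol (φ : NCFun.{u} ι) : Type (u + 1) where
  carrier : Type u
  [cstar : CStarAlgebra carrier]
  [nontrivial : Nontrivial carrier]
  val : ι → carrier
  eval_eq_zero : φ.eval val = 0

attribute [instance] NCFun.Sol.cstar NCFun.Sol.nontrivial

/-- The seminorm `p ↦ ‖p(T)‖` on `*`-polynomials that a solution `T` defines. -/
def NCFun.Sol.seminorm {φ : NCFun.{u} ι} (s : φ.Sol) : NCPoly ι → ℝ :=
  fun p => ‖NCPoly.eval s.val p‖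

/-- One solution for each seminorm that comes from a solution. (All solutions together
form a proper class; solutions with the same seminorm generate isomorphic C*-algebras.) -/
def NCFun.pick (φ : NCFun.{u} ι) (s : Set.range (NCFun.Sol.seminorm (φ := φ))) : φ.Sol :=
  s.2.choose

/-- The C*-algebra of bounded families in the product of the chosen solutions' C*-algebras. -/
abbrev NCFun.Ambient (φ : NCFun.{u} ι) : Type u :=
  lp (fun s => (φ.pick s).carrier) ∞

instance lpInfty.instCStarAlgebra {I : Type*} {A : I → Type*} [∀ i, CStarAlgebra (A i)]
    [∀ i, Nontrivial (A i)] : CStarAlgebra (lp A ∞) where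

/-- The family of all chosen solutions, as a tuple in the product. -/
def NCFun.universalTuple (φ : NCFun.{u} ι) (h : φ.NullBounded) (i : ι) : φ.Ambient :=
  ⟨fun s => (φ.pick s).val i, memℓp_infty (by
    obtain ⟨r, _, hr⟩ := h
    refine ⟨r, ?_⟩
    rintro _ ⟨s, rfl⟩
    exact hr _ _ (φ.pick s).eval_eq_zero i)⟩

/-- `C*(x₁, …, xₙ | φ)` for null-bounded `φ`: the unital C*-subalgebra that the universal tuple
generates. Its universal property is `UniversalCStar.existsUnique_lift`. -/
def UniversalCStar (φ : NCFun.{u} ι) (h : φ.NullBounded) : Type u :=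
  (StarAlgebra.adjoin ℂ (Set.range (φ.universalTuple h))).topologicalClosure

instance UniversalCStar.instCStarAlgebra (φ : NCFun.{u} ι) (h : φ.NullBounded) :
    CStarAlgebra (UniversalCStar φ h) :=
  StarSubalgebra.cstarAlgebra
    (StarAlgebra.adjoin ℂ (Set.range (φ.universalTuple h))).topologicalClosure
    (h_closed := StarSubalgebra.isClosed_topologicalClosure _)

/-- The canonical generators `x₁, …, xₙ` of `C*(x₁, …, xₙ | φ)`. -/
def UniversalCStar.gen (φ : NCFun.{u} ι) (h : φ.NullBounded) (i : ι) : UniversalCStar φ h :=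
  ⟨φ.universalTuple h i, StarSubalgebra.le_topologicalClosure _
    (StarAlgebra.subset_adjoin ℂ _ ⟨i, rfl⟩)⟩

end Universal

/-! The universal property of `C*(x₁, …, xₙ | φ)`. -/

section UniversalProperty

variable {ι : Type}

theorem NCPoly.eval_map {A B : Type u} [CStarAlgebra A] [CStarAlgebra B] (f : A →⋆ₐ[ℂ] B)
    (T : ι → A) (p : NCPoly ι) : NCPoly.eval (fun i => f (T i)) p = f (NCPoly.eval T p) := by
  have h : NCPoly.eval (fun i => f (T i)) = f.toAlgHom.comp (NCPoly.eval T) := by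
    apply FreeAlgebra.hom_ext
    funext x
    rcases x with i | i <;> simp [map_star]
  exact DFunLike.congr_fun h p

theorem NCFun.eval_map [Finite ι] (φ : NCFun.{u} ι) {A B : Type u} [CStarAlgebra A]
    [CStarAlgebra B] (f : A →⋆ₐ[ℂ] B) (T : ι → A) :
    φ.eval (fun i => f (T i)) = f (φ.eval T) := by
  obtain ⟨R, hR⟩ := (Set.finite_range fun i => ‖T i‖).bddAbove
  have hT : ∀ i, ‖T i‖ ≤ R := fun i => hR ⟨i, rfl⟩
  have hf : ∀ a, ‖f a‖ ≤ ‖a‖ := fun a => NonUnitalStarAlgHom.norm_apply_le f a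
  rw [← sub_eq_zero, ← norm_le_zero_iff]
  refine le_of_forall_pos_le_add fun ε hε => ?_
  obtain ⟨p, hp⟩ := φ.isNCContinuous R (ε / 2) (half_pos hε)
  have h1 := hp B (fun i => f (T i)) fun i => (hf _).trans (hT i)
  have h2 := (hf _).trans (hp A T hT)
  rw [map_sub, ← NCPoly.eval_map, norm_sub_rev] at h2
  calc _ = ‖(φ.eval (fun i => f (T i)) - NCPoly.eval (fun i => f (T i)) p) +
        (NCPoly.eval (fun i => f (T i)) p - f (φ.eval T))‖ := by rw [sub_add_sub_cancel]
    _ ≤ ε / 2 + ε / 2 := (norm_add_le _ _).trans (add_le_add h1 h2)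
    _ = 0 + ε := by ring

/-- The coordinate maps of the product. -/
def NCFun.Ambient.coord (φ : NCFun.{u} ι) (s : Set.range (NCFun.Sol.seminorm (φ := φ))) :
    φ.Ambient →⋆ₐ[ℂ] (φ.pick s).carrier where
  toFun x := x s
  map_one' := rfl
  map_mul' _ _ := rfl
  map_zero' := rfl
  map_add' _ _ := rfl
  commutes' _ := rfl
  map_star' _ := rfl

/-- The inclusion of `C*(x₁, …, xₙ | φ)` in the product. -/
def UniversalCStar.incl (φ : NCFun.{u} ι) (h : φ.NullBounded) :
    UniversalCStar φ h →⋆ₐ[ℂ] φ.Ambient :=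
  (StarAlgebra.adjoin ℂ (Set.range (φ.universalTuple h))).topologicalClosure.subtype

/-- The generators satisfy the relation. -/
theorem UniversalCStar.eval_gen [Finite ι] (φ : NCFun.{u} ι) (h : φ.NullBounded) :
    φ.eval (UniversalCStar.gen φ h) = 0 := by
  have hinj : Function.Injective (UniversalCStar.incl φ h) := Subtype.val_injective
  apply hinj
  rw [map_zero]
  apply lp.ext
  funext s
  change (NCFun.Ambient.coord φ s) ((UniversalCStar.incl φ h) (φ.eval (UniversalCStar.gen φ h))) = 0
  rw [← NCFun.eval_map, ← NCFun.eval_map]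
  exact (φ.pick s).eval_eq_zero

theorem NCPoly.mem_closure_range_eval {D : Type u} [CStarAlgebra D] (x : ι → D) {d : D}
    (hd : d ∈ (StarAlgebra.adjoin ℂ (Set.range x)).topologicalClosure) :
    d ∈ closure (Set.range (NCPoly.eval x)) := by
  refine closure_mono ?_ hd
  intro y hy
  induction hy using StarAlgebra.adjoin_induction with
  | mem y hy =>
    obtain ⟨i, rfl⟩ := hy
    exact ⟨FreeAlgebra.ι ℂ (Sum.inl i), NCPoly.eval_inl x i⟩
  | algebraMap c => exact ⟨algebraMap ℂ _ c, AlgHom.commutes _ _⟩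
  | add y z _ _ hy hz =>
    obtain ⟨p, rfl⟩ := hy
    obtain ⟨q, rfl⟩ := hz
    exact ⟨p + q, map_add _ _ _⟩
  | mul y z _ _ hy hz =>
    obtain ⟨p, rfl⟩ := hy
    obtain ⟨q, rfl⟩ := hz
    exact ⟨p * q, map_mul _ _ _⟩
  | star y _ hy =>
    obtain ⟨p, rfl⟩ := hy
    obtain ⟨q, hq⟩ := NCPoly.exists_star.{u} p
    exact ⟨q, hq D x⟩

/-- The generators generate: their `*`-polynomials are dense. -/
theorem UniversalCStar.denseRange_eval (φ : NCFun.{u} ι) (h : φ.NullBounded) :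
    DenseRange (NCPoly.eval (UniversalCStar.gen φ h)) := by
  intro a
  have h1 : Topology.IsInducing (UniversalCStar.incl φ h) := Topology.IsInducing.subtypeVal
  rw [h1.closure_eq_preimage_closure_image, ← Set.range_comp]
  have h2 : ⇑(UniversalCStar.incl φ h) ∘ ⇑(NCPoly.eval (UniversalCStar.gen φ h)) =
      NCPoly.eval (φ.universalTuple h) := by
    funext p
    exact (NCPoly.eval_map (UniversalCStar.incl φ h) (UniversalCStar.gen φ h) p).symm
  rw [h2]
  exact NCPoly.mem_closure_range_eval _ a.2

theorem UniversalCStar.norm_eval_le (φ : NCFun.{u} ι) (h : φ.NullBounded) {B : Type u}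
    [CStarAlgebra B] (T : ι → B) (hT : φ.eval T = 0) (p : NCPoly ι) :
    ‖NCPoly.eval T p‖ ≤ ‖NCPoly.eval (UniversalCStar.gen φ h) p‖ := by
  rcases subsingleton_or_nontrivial B with hB | hB
  · rw [Subsingleton.elim (NCPoly.eval T p) 0, norm_zero]; exact norm_nonneg _
  · let s : Set.range (NCFun.Sol.seminorm (φ := φ)) := ⟨_, ⟨⟨B, T, hT⟩, rfl⟩⟩
    have hs : ‖NCPoly.eval (φ.pick s).val p‖ = ‖NCPoly.eval T p‖ :=
      congrFun s.2.choose_spec p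
    let f := (NCFun.Ambient.coord φ s).comp (UniversalCStar.incl φ h)
    have h1 : NCPoly.eval (φ.pick s).val p = f (NCPoly.eval (UniversalCStar.gen φ h) p) :=
      NCPoly.eval_map f (UniversalCStar.gen φ h) p
    rw [← hs, h1]
    exact NonUnitalStarAlgHom.norm_apply_le f _

/-- The universal property: tuples that satisfy the relation correspond to unital `*`-homomorphisms
out of `C*(x₁, …, xₙ | φ)`. -/
theorem UniversalCStar.existsUnique_lift [Finite ι] (φ : NCFun.{u} ι) (h : φ.NullBounded)
    {B : Type u} [CStarAlgebra B] (T : ι → B) (hT : φ.eval T = 0) :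
    ∃! f : UniversalCStar φ h →⋆ₐ[ℂ] B, ∀ i, f (UniversalCStar.gen φ h i) = T i := by
  let x : ι → UniversalCStar φ h × B := fun i => (UniversalCStar.gen φ h i, T i)
  let G := (StarAlgebra.adjoin ℂ (Set.range x)).topologicalClosure
  have hG : IsClosed (G : Set (UniversalCStar φ h × B)) :=
    StarSubalgebra.isClosed_topologicalClosure _
  have := hG.completeSpace_coe
  have hfst : ∀ p, (NCPoly.eval x p).1 = NCPoly.eval (UniversalCStar.gen φ h) p := fun p =>
    (NCPoly.eval_map (StarAlgHom.fst ℂ (UniversalCStar φ h) B) x p).symm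
  have hsnd : ∀ p, (NCPoly.eval x p).2 = NCPoly.eval T p := fun p =>
    (NCPoly.eval_map (StarAlgHom.snd ℂ (UniversalCStar φ h) B) x p).symm
  have hnorm : ∀ d ∈ G, ‖d‖ = ‖d.1‖ := by
    intro d hd
    have hc : IsClosed {d : UniversalCStar φ h × B | ‖d‖ = ‖d.1‖} :=
      isClosed_eq continuous_norm (continuous_norm.comp continuous_fst)
    refine closure_minimal ?_ hc (NCPoly.mem_closure_range_eval x hd)
    rintro _ ⟨p, rfl⟩
    change ‖NCPoly.eval x p‖ = ‖(NCPoly.eval x p).1‖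
    rw [Prod.norm_def, hfst, hsnd]
    exact max_eq_left (UniversalCStar.norm_eval_le φ h T hT p)
  let F : G →⋆ₐ[ℂ] UniversalCStar φ h := (StarAlgHom.fst ℂ (UniversalCStar φ h) B).comp G.subtype
  have hF : Isometry F := AddMonoidHomClass.isometry_of_norm F fun d => (hnorm d d.2).symm
  have hFs : Function.Surjective F := by
    intro a
    have hcl : IsClosed (Set.range F) := hF.isClosedEmbedding.isClosed_range
    refine closure_minimal ?_ hcl (UniversalCStar.denseRange_eval φ h a)
    rintro _ ⟨p, rfl⟩
    have hx : ∀ i, x i ∈ G := fun i => StarSubalgebra.le_topologicalClosure _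
      (StarAlgebra.subset_adjoin ℂ _ ⟨i, rfl⟩)
    have hp : NCPoly.eval x p ∈ G := by
      induction p using FreeAlgebra.induction with
      | grade0 r => rw [AlgHom.commutes]; exact algebraMap_mem G r
      | grade1 y =>
        rcases y with i | i
        · rw [NCPoly.eval_inl]; exact hx i
        · rw [NCPoly.eval_inr]; exact star_mem (hx i)
      | mul p q hp hq => rw [map_mul]; exact mul_mem hp hq
      | add p q hp hq => rw [map_add]; exact add_mem hp hq
    exact ⟨⟨_, hp⟩, hfst p⟩
  let e : G ≃⋆ₐ[ℂ] UniversalCStar φ h := StarAlgEquiv.ofBijective F ⟨hF.injective, hFs⟩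
  let S : G →⋆ₐ[ℂ] B := (StarAlgHom.snd ℂ (UniversalCStar φ h) B).comp G.subtype
  have he : ∀ g, e.symm (F g) = g := fun g => e.symm_apply_apply g
  have hf : ∀ i,
      S.comp (e.symm : UniversalCStar φ h →⋆ₐ[ℂ] G) (UniversalCStar.gen φ h i) = T i := by
    intro i
    have hx : x i ∈ G := StarSubalgebra.le_topologicalClosure _
      (StarAlgebra.subset_adjoin ℂ _ ⟨i, rfl⟩)
    exact congrArg S (he ⟨x i, hx⟩)
  refine ⟨S.comp (e.symm : UniversalCStar φ h →⋆ₐ[ℂ] G), hf, fun g hg => ?_⟩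
  apply DFunLike.coe_injective
  have hc : ∀ k : UniversalCStar φ h →⋆ₐ[ℂ] B, Continuous k := fun k =>
    AddMonoidHomClass.continuous_of_bound k 1 fun a => by
      rw [one_mul]; exact NonUnitalStarAlgHom.norm_apply_le k a
  refine (UniversalCStar.denseRange_eval φ h).equalizer (hc _) (hc _) ?_
  funext p
  have h1 := NCPoly.eval_map g (UniversalCStar.gen φ h) p
  have h2 := NCPoly.eval_map (S.comp (e.symm : UniversalCStar φ h →⋆ₐ[ℂ] G))
    (UniversalCStar.gen φ h) p
  rw [funext hg] at h1
  rw [funext hf] at h2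
  exact h1.symm.trans h2

end UniversalProperty

/-! ### Semiprojectivity and weak semiprojectivity in the unital category -/

/-- `q : B → C` is the quotient map of `B` by the ideal `J`, up to isomorphism: a surjective unital
`*`-homomorphism of C*-algebras with kernel `J`. -/
def IsQuotientHom {B C : Type u} [CStarAlgebra B] [CStarAlgebra C] (q : B →⋆ₐ[ℂ] C) (J : Set B) :
    Prop :=
  Function.Surjective q ∧ ∀ b, q b = 0 ↔ b ∈ J

/-- `A` is semiprojective: for every increasing sequence of closed ideals `J n` of a unital
C*-algebra `B`, with quotients `Q n = B / J n` and `C = B / closure (⋃ n, J n)` and natural maps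
`r n : Q n → C`, every unital `*`-homomorphism `A → C` factors through some `r N`. -/
def Semiprojective (A : Type u) [CStarAlgebra A] : Prop :=
  ∀ (B : Type u) [CStarAlgebra B] (J : ℕ → TwoSidedIdeal B),
    Monotone J → (∀ n, IsClosed (J n : Set B)) →
    ∀ (Q : ℕ → Type u) [∀ n, CStarAlgebra (Q n)] (C : Type u) [CStarAlgebra C]
      (q : ∀ n, B →⋆ₐ[ℂ] Q n) (qC : B →⋆ₐ[ℂ] C) (r : ∀ n, Q n →⋆ₐ[ℂ] C),
      (∀ n, IsQuotientHom (q n) (J n)) → IsQuotientHom qC (closure (⋃ n, (J n : Set B))) →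
      (∀ n, (r n).comp (q n) = qC) →
      ∀ π : A →⋆ₐ[ℂ] C, ∃ (N : ℕ) (πN : A →⋆ₐ[ℂ] Q N), π = (r N).comp πN

/-- The C*-algebra `∏ n, B n` of bounded sequences, as a `*`-algebra. -/
def boundedSeq (B : ℕ → Type u) [∀ n, CStarAlgebra (B n)] : StarSubalgebra ℂ (∀ n, B n) where
  carrier := {x | BddAbove (Set.range fun n => ‖x n‖)}
  mul_mem' := by
    rintro x y ⟨C, hC⟩ ⟨D, hD⟩
    refine ⟨C * D, ?_⟩
    rintro _ ⟨n, rfl⟩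
    exact (norm_mul_le _ _).trans (mul_le_mul (hC ⟨n, rfl⟩) (hD ⟨n, rfl⟩) (norm_nonneg _)
      ((norm_nonneg _).trans (hC ⟨n, rfl⟩)))
  add_mem' := by
    rintro x y ⟨C, hC⟩ ⟨D, hD⟩
    refine ⟨C + D, ?_⟩
    rintro _ ⟨n, rfl⟩
    exact (norm_add_le _ _).trans (add_le_add (hC ⟨n, rfl⟩) (hD ⟨n, rfl⟩))
  algebraMap_mem' c := by
    refine ⟨‖c‖, ?_⟩
    rintro _ ⟨n, rfl⟩
    change ‖algebraMap ℂ (B n) c‖ ≤ ‖c‖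
    rw [Algebra.algebraMap_eq_smul_one, norm_smul]
    exact mul_le_of_le_one_right (norm_nonneg _) (CStarAlgebra.norm_one_le_one (B n))
  star_mem' := by
    rintro x ⟨C, hC⟩
    refine ⟨C, ?_⟩
    rintro _ ⟨n, rfl⟩
    change ‖star (x n)‖ ≤ C
    rw [norm_star]
    exact hC ⟨n, rfl⟩

/-- `q` is, up to isomorphism, the quotient map `∏ n, B n → (∏ n, B n) / (⨁ n, B n)`: a surjective
unital `*`-homomorphism onto a C*-algebra whose kernel `⨁ n, B n` is the ideal of the sequences
that tend to `0` in norm. -/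
def IsSeqQuotientHom {B : ℕ → Type u} [∀ n, CStarAlgebra (B n)] {C : Type u} [CStarAlgebra C]
    (q : boundedSeq B →⋆ₐ[ℂ] C) : Prop :=
  Function.Surjective q ∧
    ∀ x, q x = 0 ↔ Filter.Tendsto (fun n => ‖(x : ∀ n, B n) n‖) Filter.atTop (nhds 0)

/-- `A` is weakly semiprojective: every unital `*`-homomorphism `π : A → (∏ n, B n) / (⨁ n, B n)`
is given by functions `ρ n : A → B n`, `π a = [(ρ n a)]`, that are unital `*`-homomorphisms for
all `n ≥ N`. -/
def WeaklySemiprojective (A : Type u) [CStarAlgebra A] : Prop :=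
  ∀ (B : ℕ → Type u) [∀ n, CStarAlgebra (B n)] (C : Type u) [CStarAlgebra C]
    (q : boundedSeq B →⋆ₐ[ℂ] C), IsSeqQuotientHom q →
    ∀ π : A →⋆ₐ[ℂ] C, ∃ (ρ : ∀ n, A → B n) (N : ℕ),
      (∀ n, N ≤ n → ∃ f : A →⋆ₐ[ℂ] B n, ⇑f = ρ n) ∧
      ∀ a, ∃ h : (fun n => ρ n a) ∈ boundedSeq B, π a = q ⟨fun n => ρ n a, h⟩

end

/-! A solution `V` of the glued relation is a tuple of partial isometries whose supports `star (V i)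
* V i` and ranges `V i * star (V i)` solve the original relations: a sum of two elements `star c *
c` vanishes only if both do. (Weak) semiprojectivity of the original algebras lifts supports and
ranges to projections that still satisfy those relations. It remains to lift the partial isometries
between the lifted projections without moving the projections.

This is a polar decomposition. Let `a` and `b` be the lifted support and range, and let `w` be any
lift of the partial isometry. Then `x = b * w * a` satisfies `x * a = x` and `b * x = x`, and `star
x * x` and `x * star x` are close to `a` and `b` far enough along the tower or the sequence. The
element `star x * x + (1 - a)` is then within distance less than `1` of the unit, so its inverse
square root exists, and `polarPart a x` has support exactly `a` and range exactly `b`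
(`star_polarPart_mul_self`, `polarPart_mul_star_self`).

The polar part must still lift the given partial isometry. For ideal towers, a homomorphism that
sends `x` to an element with support the image of `a` sends the inverse square root to `1`
(`map_polarPart`). For sequences, the estimate `norm_polarPart_sub_le` shows that passing to the
polar part changes `x` by a null sequence. By the universal property, lifting homomorphisms amounts
to lifting solution tuples, which turns these facts into the theorem. -/

open Filter Topology

/-! ### Polar parts of approximate partial isometries. -/

section PolarPart

variable {A : Type u} [CStarAlgebra A] {p q x : A}

/-- The usual spectral radius bound, with `‖1‖ ≤ 1` in place of `‖1‖ = 1` because the zero algebra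
is allowed. -/
theorem norm_le_of_mem_spectrum_real {a : A} {t : ℝ} (ht : t ∈ spectrum ℝ a) : |t| ≤ ‖a‖ := by
  have h := spectrum.norm_le_norm_mul_of_mem ht
  rw [Real.norm_eq_abs] at h
  exact h.trans (mul_le_of_le_one_right (norm_nonneg _) (CStarAlgebra.norm_one_le_one A))

theorem abs_sub_one_le_of_mem_spectrum_real {a : A} {t : ℝ} (ht : t ∈ spectrum ℝ a) :
    |t - 1| ≤ ‖a - 1‖ := by
  apply norm_le_of_mem_spectrum_real
  rw [spectrum.mem_iff] at ht ⊢
  rwa [map_sub, map_one, sub_sub_sub_cancel_right]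

/-- The partial isometry `x |x|⁻¹` of an element `x = x p` that is bounded below on the range of the
projection `p`. -/
noncomputable def polarPart (p x : A) : A :=
  x * cfc (fun t : ℝ => (√t)⁻¹) (star x * x + (1 - p))

theorem polarPart_supp_isSelfAdjoint (hp : IsStarProjection p) :
    IsSelfAdjoint (star x * x + (1 - p)) :=
  (IsSelfAdjoint.star_mul_self x).add ((IsSelfAdjoint.one A).sub hp.isSelfAdjoint)

theorem continuousOn_inv_sqrt {s : Set ℝ} (hs : ∀ t ∈ s, 0 < t) :
    ContinuousOn (fun t : ℝ => (√t)⁻¹) s :=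
  Real.continuous_sqrt.continuousOn.inv₀ fun t ht => (Real.sqrt_pos.2 (hs t ht)).ne'

theorem pos_of_mem_spectrum_of_norm_sub_one_lt {a : A} (ha : ‖a - 1‖ < 1) :
    ∀ t ∈ spectrum ℝ a, 0 < t := fun t ht => by
  have := (abs_lt.1 ((abs_sub_one_le_of_mem_spectrum_real ht).trans_lt ha)).1
  linarith

theorem cfc_inv_sqrt_mul_self_mul {a : A} (ha : IsSelfAdjoint a) (h : ‖a - 1‖ < 1) :
    cfc (fun t : ℝ => (√t)⁻¹) a * cfc (fun t : ℝ => (√t)⁻¹) a * a = 1 := by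
  have hpos := pos_of_mem_spectrum_of_norm_sub_one_lt h
  have hc := continuousOn_inv_sqrt hpos
  calc _ = cfc (fun t : ℝ => (√t)⁻¹) a * cfc (fun t : ℝ => (√t)⁻¹) a * cfc (fun t : ℝ => t) a := by
        rw [cfc_id' ℝ a]
    _ = cfc (fun t : ℝ => (√t)⁻¹ * (√t)⁻¹ * t) a := by
        rw [← cfc_mul _ _ a hc hc, ← cfc_mul (fun t : ℝ => (√t)⁻¹ * (√t)⁻¹) (fun t => t) a
          (hc.mul hc) continuousOn_id]
    _ = cfc (fun _ : ℝ => (1 : ℝ)) a := by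
        refine cfc_congr fun t ht => ?_
        have ht := hpos t ht
        change (√t)⁻¹ * (√t)⁻¹ * t = 1
        rw [← mul_inv, Real.mul_self_sqrt ht.le, inv_mul_cancel₀ ht.ne']
    _ = 1 := cfc_const_one ℝ a

/-- The summand `1 - p` makes `a = star x * x + (1 - p)` invertible in the whole algebra. Both `a`
and `y = a^(-1/2)` commute with `p`, and compressing `y * a * y = 1` to the corner of `p` gives the
claim. -/
theorem star_polarPart_mul_self (hp : IsStarProjection p) (hx : x * p = x)
    (h : ‖star x * x - p‖ < 1) : star (polarPart p x) * polarPart p x = p := by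
  set a := star x * x + (1 - p) with ha
  have hsa : IsSelfAdjoint a := polarPart_supp_isSelfAdjoint hp
  have h1 : ‖a - 1‖ < 1 := by rwa [show a - 1 = star x * x - p by rw [ha]; abel]
  set y := cfc (fun t : ℝ => (√t)⁻¹) a with hy
  have hys : star y = y := (cfc_predicate (R := ℝ) _ a : IsSelfAdjoint y)
  have hyya : y * y * a = 1 := cfc_inv_sqrt_mul_self_mul hsa h1
  have hya : y * a = a * y := ((Commute.refl a).cfc_real _).eq
  have hpx : p * star x = star x := by
    conv_rhs => rw [← hx, star_mul, hp.isSelfAdjoint.star_eq]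
  have hpp : p * p = p := hp.isIdempotentElem
  have hpa : a * p = p * a := by
    rw [ha]
    simp only [add_mul, mul_add, sub_mul, mul_sub, one_mul, mul_one, hpp, mul_assoc, hx]
    rw [← mul_assoc p, hpx]
  -- On the complement of `p` the element `a` is the identity, hence so is `y * y`.
  have hpa' : (1 - p) * a = 1 - p := by
    rw [ha]
    simp only [mul_add, sub_mul, mul_sub, one_mul, mul_one, hpp]
    rw [← mul_assoc p, hpx]; abel
  have hyp : y * p = p * y := (Commute.cfc_real (show Commute a p from hpa) _).eq
  have h2 : (1 - p) * (y * y) = 1 - p := by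
    calc (1 - p) * (y * y) = (1 - p) * a * (y * y) := by rw [hpa']
      _ = (1 - p) * (y * y * a) := by
        rw [mul_assoc, mul_assoc y, hya, ← mul_assoc y, hya, mul_assoc a]
      _ = 1 - p := by rw [hyya, mul_one]
  calc star (polarPart p x) * polarPart p x = y * (a - (1 - p)) * y := by
        rw [polarPart, star_mul, ← ha, ← hy, hys, ha]
        simp only [add_sub_cancel_right, mul_assoc]
    _ = y * y * a - (1 - p) * (y * y) := by
        rw [mul_sub, sub_mul, mul_assoc, ← hya, ← mul_assoc, mul_sub, mul_one, hyp]
        noncomm_ring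
    _ = p := by rw [hyya, h2]; abel

/-- The range `e = x * a⁻¹ * star x` acts as a left unit on `x * star x`, because `a * star x = star
x * (x * star x)`. Since `x * star x` is close to `q`, it is invertible in the corner of `q`, which
forces `e = q`. -/
theorem polarPart_mul_star_self (hp : IsStarProjection p) (hq : IsStarProjection q)
    (hx : x * p = x) (hqx : q * x = x) (h : ‖star x * x - p‖ < 1) (h' : ‖x * star x - q‖ < 1) :
    polarPart p x * star (polarPart p x) = q := by
  set a := star x * x + (1 - p) with ha
  have hsa : IsSelfAdjoint a := polarPart_supp_isSelfAdjoint hp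
  have h1 : ‖a - 1‖ < 1 := by rwa [show a - 1 = star x * x - p by rw [ha]; abel]
  set y := cfc (fun t : ℝ => (√t)⁻¹) a with hy
  have hys : star y = y := (cfc_predicate (R := ℝ) _ a : IsSelfAdjoint y)
  have hyya : y * y * a = 1 := cfc_inv_sqrt_mul_self_mul hsa h1
  have hpx : p * star x = star x := by
    conv_rhs => rw [← hx, star_mul, hp.isSelfAdjoint.star_eq]
  have hax : a * star x = star x * (x * star x) := by
    rw [ha, add_mul, sub_mul, one_mul, hpx, sub_self, add_zero, mul_assoc]
  have he : polarPart p x * star (polarPart p x) = x * (y * y) * star x := by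
    rw [polarPart, star_mul, ← ha, ← hy, hys]
    simp only [mul_assoc]
  have hex : x * (y * y) * star x * (x * star x) = x * star x := by
    rw [mul_assoc, ← hax, mul_assoc, ← mul_assoc (y * y), hyya, one_mul]
  have hxq : star x * q = star x := by
    conv_rhs => rw [← hqx, star_mul, hq.isSelfAdjoint.star_eq]
  have hqq : q * q = q := hq.isIdempotentElem
  have hu : IsUnit (x * star x + (1 - q)) := by
    have := isUnit_one_sub_of_norm_lt_one (x := q - x * star x) (by rwa [norm_sub_rev])
    rwa [show 1 - (q - x * star x) = x * star x + (1 - q) by abel] at this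
  -- The product of `e - q` with the unit `x * star x + (1 - q)` is zero.
  rw [he, ← sub_eq_zero]
  apply (hu.mul_left_eq_zero).1
  rw [sub_mul, mul_add, mul_add, hex, mul_sub, mul_sub, mul_one, mul_one, mul_assoc _ (star x) q,
    hxq, hqq, sub_self, sub_self, ← mul_assoc, hqx, sub_self]

/-- The image of `star x * x + (1 - p)` is `1`, so its inverse square root is mapped to `1` by
naturality of the functional calculus. -/
theorem map_polarPart {B : Type u} [CStarAlgebra B] (f : A →⋆ₐ[ℂ] B) (hp : IsStarProjection p)
    (h : ‖star x * x - p‖ < 1) (hf : star (f x) * f x = f p) :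
    f (polarPart p x) = f x := by
  have hsa : IsSelfAdjoint (star x * x + (1 - p)) := polarPart_supp_isSelfAdjoint hp
  have h1 : ‖star x * x + (1 - p) - 1‖ < 1 := by
    rwa [show star x * x + (1 - p) - 1 = star x * x - p by abel]
  have hcf : Continuous f := AddMonoidHomClass.continuous_of_bound f 1 fun a => by
    rw [one_mul]; exact NonUnitalStarAlgHom.norm_apply_le f a
  rw [polarPart, map_mul, StarAlgHomClass.map_cfc (S := ℂ) f _ _
    (continuousOn_inv_sqrt (pos_of_mem_spectrum_of_norm_sub_one_lt h1)) hcf hsa (hsa.map f)]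
  have h2 : f (star x * x + (1 - p)) = 1 := by
    rw [map_add, map_mul, map_star, hf, map_sub, map_one]; abel
  rw [h2, cfc_apply_one]
  simp

/-- This follows from `t - 1 = (√t - 1) * (√t + 1)` and `√t ≥ 1 / 2`. The latter is crude but gives
the constant `2`. -/
theorem abs_inv_sqrt_sub_one_le {t : ℝ} (ht : |t - 1| ≤ 1 / 2) : |(√t)⁻¹ - 1| ≤ 2 * |t - 1| := by
  have h1 : 1 / 2 ≤ t := by have := (abs_le.1 ht).1; linarith
  have hs : √t * √t = t := Real.mul_self_sqrt (by linarith)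
  have hs0 : 0 ≤ √t := Real.sqrt_nonneg t
  have hs1 : 1 / 2 ≤ √t := by nlinarith
  have e1 : (√t)⁻¹ - 1 = (√t)⁻¹ * (1 - √t) := by
    rw [mul_sub, mul_one, inv_mul_cancel₀ (by linarith)]
  have e2 : |t - 1| = |1 - √t| * (1 + √t) := by
    rw [abs_sub_comm, show 1 - t = (1 - √t) * (1 + √t) by linear_combination hs, abs_mul,
      abs_of_nonneg (by linarith : 0 ≤ 1 + √t)]
  have hi : (√t)⁻¹ ≤ 2 := by
    rw [inv_le_comm₀ (by linarith) two_pos]; linarith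
  rw [e1, abs_mul, abs_of_nonneg (inv_nonneg.2 hs0), e2]
  refine mul_le_mul hi (le_mul_of_one_le_right (abs_nonneg _) (by linarith)) (abs_nonneg _)
    zero_le_two

theorem norm_polarPart_sub_le (hp : IsStarProjection p) (h : ‖star x * x - p‖ ≤ 1 / 2) :
    ‖polarPart p x - x‖ ≤ ‖x‖ * (2 * ‖star x * x - p‖) := by
  set a := star x * x + (1 - p) with ha
  have hsa : IsSelfAdjoint a := polarPart_supp_isSelfAdjoint hp
  have ha1 : a - 1 = star x * x - p := by rw [ha]; abel
  rw [← ha1] at h ⊢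
  have hpos := pos_of_mem_spectrum_of_norm_sub_one_lt (h.trans_lt one_half_lt_one)
  have e : polarPart p x - x = x * cfc (fun t : ℝ => (√t)⁻¹ - 1) a := by
    rw [cfc_sub _ _ a (continuousOn_inv_sqrt hpos) continuousOn_const, cfc_const_one ℝ a, mul_sub,
      mul_one, polarPart]
  rw [e]
  refine (norm_mul_le _ _).trans (mul_le_mul_of_nonneg_left ?_ (norm_nonneg _))
  refine norm_cfc_le (by positivity) fun t ht => ?_
  have h2 := abs_sub_one_le_of_mem_spectrum_real ht
  exact (abs_inv_sqrt_sub_one_le (h2.trans h)).trans (by linarith)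

/-- With `d = v * p - v`, all four terms of `star d * d` equal `p` up to sign and cancel. -/
theorem mul_eq_self_of_star_mul_self {v p : A} (hp : IsStarProjection p) (hv : star v * v = p) :
    v * p = v := by
  have hpp : p * p = p := hp.isIdempotentElem
  rw [← sub_eq_zero, ← CStarRing.star_mul_self_eq_zero_iff, star_sub, star_mul,
    hp.isSelfAdjoint.star_eq, sub_mul, mul_sub, mul_sub, ← mul_assoc (star v), hv,
    mul_assoc p, ← mul_assoc (star v), hv, mul_assoc p, hv, hpp, hpp, sub_self]

theorem mul_eq_self_of_mul_star_self {v p : A} (hp : IsStarProjection p) (hv : v * star v = p) :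
    p * v = v := by
  rw [← star_inj, star_mul, hp.isSelfAdjoint.star_eq]
  exact mul_eq_self_of_star_mul_self hp (by rw [star_star, hv])

end PolarPart

/-! ### Solutions of the glued relations, and homomorphisms as solution tuples. -/

section Relations

theorem star_mul_self_add_star_mul_self_eq_zero {A : Type u} [CStarAlgebra A] {a b : A} :
    star a * a + star b * b = 0 ↔ a = 0 ∧ b = 0 := by
  let _ := CStarAlgebra.spectralOrder A
  have := CStarAlgebra.spectralOrderedRing A
  rw [add_eq_zero_iff_of_nonneg (star_mul_self_nonneg a) (star_mul_self_nonneg b),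
    CStarRing.star_mul_self_eq_zero_iff, CStarRing.star_mul_self_eq_zero_iff]

theorem NCFun.glue_eval_eq_zero_iff {n : ℕ} (φ ψ : NCFun.{u} (Fin n)) {B : Type u} [CStarAlgebra B]
    (V : Fin n → B) : (NCFun.glue φ ψ).eval V = 0 ↔
      φ.eval (fun i => star (V i) * V i) = 0 ∧ ψ.eval (fun i => V i * star (V i)) = 0 :=
  star_mul_self_add_star_mul_self_eq_zero

theorem NCFun.glueJoint_eval_eq_zero_iff {n : ℕ} (φ : NCFun.{u} (Fin n ⊕ Fin n)) {B : Type u}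
    [CStarAlgebra B] (V : Fin n → B) : (NCFun.glueJoint φ).eval V = 0 ↔
      φ.eval (Sum.elim (fun i => star (V i) * V i) fun i => V i * star (V i)) = 0 :=
  CStarRing.star_mul_self_eq_zero_iff _

/-- Here `‖a‖ ^ 2 ≤ r`, and `r + 1` is a convenient upper bound for `√r`. -/
theorem norm_le_add_one_of_norm_star_mul_self_le {A : Type u} [CStarAlgebra A] {a : A} {r : ℝ}
    (h : ‖star a * a‖ ≤ r) : ‖a‖ ≤ r + 1 := by
  rw [CStarRing.norm_star_mul_self] at h
  nlinarith [sq_nonneg (‖a‖ - 1)]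

theorem NCFun.NullBounded.glue {n : ℕ} {φ : NCFun.{u} (Fin n)} (hφ : φ.NullBounded)
    (ψ : NCFun.{u} (Fin n)) : (NCFun.glue φ ψ).NullBounded := by
  obtain ⟨r, hr, h⟩ := hφ
  exact ⟨r + 1, by positivity, fun B _ V hV i => norm_le_add_one_of_norm_star_mul_self_le
    (h B _ ((NCFun.glue_eval_eq_zero_iff φ ψ V).1 hV).1 i)⟩

theorem NCFun.NullBounded.glueJoint {n : ℕ} {φ : NCFun.{u} (Fin n ⊕ Fin n)}
    (hφ : φ.NullBounded) : (NCFun.glueJoint φ).NullBounded := by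
  obtain ⟨r, hr, h⟩ := hφ
  exact ⟨r + 1, by positivity, fun B _ V hV i => norm_le_add_one_of_norm_star_mul_self_le
    (h B _ ((NCFun.glueJoint_eval_eq_zero_iff φ V).1 hV) (Sum.inl i))⟩

variable {ι : Type} [Finite ι] {φ : NCFun.{u} ι} (h : φ.NullBounded)

/-- The `*`-homomorphism out of `C*(x₁, …, xₙ | φ)` that a solution of `φ(T) = 0` defines. -/
noncomputable def UniversalCStar.lift {B : Type u} [CStarAlgebra B] {T : ι → B} (hT : φ.eval T = 0) :
    UniversalCStar φ h →⋆ₐ[ℂ] B :=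
  (UniversalCStar.existsUnique_lift φ h T hT).choose

@[simp] theorem UniversalCStar.lift_gen {B : Type u} [CStarAlgebra B] {T : ι → B}
    (hT : φ.eval T = 0) (i : ι) : UniversalCStar.lift h hT (UniversalCStar.gen φ h i) = T i :=
  (UniversalCStar.existsUnique_lift φ h T hT).choose_spec.1 i

theorem UniversalCStar.eval_map_gen {B : Type u} [CStarAlgebra B]
    (f : UniversalCStar φ h →⋆ₐ[ℂ] B) : φ.eval (fun i => f (UniversalCStar.gen φ h i)) = 0 := by
  rw [NCFun.eval_map, UniversalCStar.eval_gen, map_zero]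

theorem UniversalCStar.hom_ext {B : Type u} [CStarAlgebra B] {f g : UniversalCStar φ h →⋆ₐ[ℂ] B}
    (hfg : ∀ i, f (UniversalCStar.gen φ h i) = g (UniversalCStar.gen φ h i)) : f = g :=
  (UniversalCStar.existsUnique_lift φ h _ (UniversalCStar.eval_map_gen h g)).unique hfg fun _ => rfl

/-- Every solution is the image of the generators under a `*`-homomorphism, so the assumption on the
generators applies to all solutions. -/
theorem UniversalCStar.isStarProjection_of_eval_eq_zero
    (hg : ∀ i, IsStarProjection (UniversalCStar.gen φ h i)) {B : Type u} [CStarAlgebra B]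
    {T : ι → B} (hT : φ.eval T = 0) (i : ι) : IsStarProjection (T i) := by
  rw [← UniversalCStar.lift_gen h hT i]
  exact (hg i).map _

end Relations

/-! ### Lifting along towers of ideals: semiprojectivity. -/

section Semiprojective

/-- `Q n = B / J n` and `C = B / closure (⋃ n, J n)` for an increasing sequence of ideals `J n`, with
natural maps `r n : Q n → C`. -/
structure IsIdealTower {B C : Type u} [CStarAlgebra B] [CStarAlgebra C] (J : ℕ → TwoSidedIdeal B)
    {Q : ℕ → Type u} [∀ n, CStarAlgebra (Q n)] (q : ∀ n, B →⋆ₐ[ℂ] Q n) (qC : B →⋆ₐ[ℂ] C)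
    (r : ∀ n, Q n →⋆ₐ[ℂ] C) : Prop where
  mono : Monotone J
  isQuotientHom : ∀ n, IsQuotientHom (q n) (J n)
  isQuotientHom_limit : IsQuotientHom qC (closure (⋃ n, (J n : Set B)))
  comp_eq : ∀ n, (r n).comp (q n) = qC

/-- A `*`-homomorphism that vanishes on the kernel of a surjective one factors through it. -/
theorem StarAlgHom.exists_comp_eq {A B C : Type u} [CStarAlgebra A] [CStarAlgebra B]
    [CStarAlgebra C] (f : A →⋆ₐ[ℂ] B) (hf : Function.Surjective f) (g : A →⋆ₐ[ℂ] C)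
    (hfg : ∀ a, f a = 0 → g a = 0) : ∃ k : B →⋆ₐ[ℂ] C, ∀ a, k (f a) = g a := by
  have key : ∀ a b, f a = f b → g a = g b := fun a b hab => by
    rw [← sub_eq_zero, ← map_sub]
    exact hfg _ (by rw [map_sub, hab, sub_self])
  -- The section `s` is only a map of sets. By `key` the value `g (s b)` does not depend on its
  -- choice, which yields all the algebraic identities.
  obtain ⟨s, hs⟩ := hf.hasRightInverse
  refine ⟨{ toFun := fun b => g (s b), map_one' := ?_, map_mul' := fun x y => ?_, map_zero' := ?_,
            map_add' := fun x y => ?_, commutes' := fun c => ?_, map_star' := fun x => ?_ },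
    fun a => key _ _ (hs _)⟩
  · rw [← map_one g]; exact key _ _ (by rw [hs, map_one])
  · rw [← map_mul]; exact key _ _ (by rw [map_mul, hs, hs, hs])
  · rw [← map_zero g]; exact key _ _ (by rw [hs, map_zero])
  · rw [← map_add]; exact key _ _ (by rw [map_add, hs, hs, hs])
  · rw [← AlgHomClass.commutes g]; exact key _ _ (by rw [hs, AlgHomClass.commutes])
  · rw [← map_star]; exact key _ _ (by rw [map_star, hs, hs])

namespace IsIdealTower

variable {B C : Type u} [CStarAlgebra B] [CStarAlgebra C] {J : ℕ → TwoSidedIdeal B}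
  {Q : ℕ → Type u} [∀ n, CStarAlgebra (Q n)] {q : ∀ n, B →⋆ₐ[ℂ] Q n} {qC : B →⋆ₐ[ℂ] C}
  {r : ∀ n, Q n →⋆ₐ[ℂ] C}

theorem apply_apply (t : IsIdealTower J q qC r) (n : ℕ) (b : B) : r n (q n b) = qC b :=
  DFunLike.congr_fun (t.comp_eq n) b

theorem exists_transition (t : IsIdealTower J q qC r) {m n : ℕ} (hmn : m ≤ n) :
    ∃ k : Q m →⋆ₐ[ℂ] Q n, ∀ b, k (q m b) = q n b :=
  StarAlgHom.exists_comp_eq (q m) (t.isQuotientHom m).1 (q n) fun b hb =>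
    ((t.isQuotientHom n).2 b).2 (t.mono hmn (((t.isQuotientHom m).2 b).1 hb))

/-- An element of the closure of the union of the ideals is within `ε` of some element of a single
`J m`, and the latter dies in all `Q n` with `n ≥ m`. -/
theorem eventually_norm_lt (t : IsIdealTower J q qC r) {b : B} (hb : qC b = 0) {ε : ℝ}
    (hε : 0 < ε) : ∀ᶠ n in atTop, ‖q n b‖ < ε := by
  obtain ⟨j, hj, hbj⟩ := Metric.mem_closure_iff.1 ((t.isQuotientHom_limit.2 b).1 hb) ε hε
  obtain ⟨m, hm⟩ := Set.mem_iUnion.1 hj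
  filter_upwards [eventually_ge_atTop m] with n hn
  have h0 : q n j = 0 := ((t.isQuotientHom n).2 j).2 (t.mono hn hm)
  rw [dist_eq_norm] at hbj
  rw [← sub_zero (q n b), ← h0, ← map_sub]
  exact (NonUnitalStarAlgHom.norm_apply_le (q n) _).trans_lt hbj

theorem eventually_eval_eq_zero (t : IsIdealTower J q qC r) {ι : Type} [Finite ι]
    (φ : NCFun.{u} ι) {m : ℕ} {b : ι → B} (hb : φ.eval (fun i => q m (b i)) = 0) :
    ∀ᶠ n in atTop, φ.eval (fun i => q n (b i)) = 0 := by
  filter_upwards [eventually_ge_atTop m] with n hn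
  obtain ⟨k, hk⟩ := t.exists_transition hn
  simp_rw [← hk]
  rw [NCFun.eval_map, hb, map_zero]

/-- Partial isometries whose support and range projections lift along a tower lift with them. -/
theorem exists_partialIsometry_lift (t : IsIdealTower J q qC r) {ι : Type} [Finite ι]
    {a b : ι → B} (ha : ∀ᶠ n in atTop, ∀ i, IsStarProjection (q n (a i)))
    (hb : ∀ᶠ n in atTop, ∀ i, IsStarProjection (q n (b i))) {v : ι → C}
    (hva : ∀ i, star (v i) * v i = qC (a i)) (hvb : ∀ i, v i * star (v i) = qC (b i)) :
    ∀ᶠ n in atTop, ∃ V : ι → Q n, (∀ i, r n (V i) = v i) ∧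
      (∀ i, star (V i) * V i = q n (a i)) ∧ ∀ i, V i * star (V i) = q n (b i) := by
  choose w hw using fun i => t.isQuotientHom_limit.1 (v i)
  -- A single level where the lifts are projections suffices to make their images in `C`
  -- projections.
  obtain ⟨N, hN, hN'⟩ := (ha.and hb).exists
  have hap : ∀ i, IsStarProjection (qC (a i)) := fun i => by
    rw [← t.apply_apply N]; exact (hN i).map _
  have hbp : ∀ i, IsStarProjection (qC (b i)) := fun i => by
    rw [← t.apply_apply N]; exact (hN' i).map _
  have hva' : ∀ i, v i * qC (a i) = v i := fun i =>
    mul_eq_self_of_star_mul_self (hap i) (hva i)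
  have hvb' : ∀ i, qC (b i) * v i = v i := fun i =>
    mul_eq_self_of_mul_star_self (hbp i) (hvb i)
  -- Cutting down by `a` and `b` does not change the image `v` in `C`. It places the lift in the
  -- right corner at every level where `a` and `b` become projections.
  let x : ι → B := fun i => b i * w i * a i
  have hx : ∀ i, qC (x i) = v i := fun i => by
    simp only [x, map_mul, hw, hvb', hva']
  have e1 : ∀ᶠ n in atTop, ∀ i, ‖q n (star (x i) * x i - a i)‖ < 1 :=
    eventually_all.2 fun i => t.eventually_norm_lt
      (by rw [map_sub, map_mul, map_star, hx, hva, sub_self]) one_pos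
  have e2 : ∀ᶠ n in atTop, ∀ i, ‖q n (x i * star (x i) - b i)‖ < 1 :=
    eventually_all.2 fun i => t.eventually_norm_lt
      (by rw [map_sub, map_mul, map_star, hx, hvb, sub_self]) one_pos
  filter_upwards [ha, hb, e1, e2] with n h1 h2 h3 h4
  simp only [map_sub, map_mul, map_star] at h3 h4
  have hxa : ∀ i, q n (x i) * q n (a i) = q n (x i) := fun i => by
    simp only [x, map_mul, mul_assoc, (h1 i).isIdempotentElem.eq]
  have hxb : ∀ i, q n (b i) * q n (x i) = q n (x i) := fun i => by
    simp only [x, map_mul, ← mul_assoc, (h2 i).isIdempotentElem.eq]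
  refine ⟨fun i => polarPart (q n (a i)) (q n (x i)), fun i => ?_, fun i => ?_, fun i => ?_⟩
  · rw [map_polarPart (r n) (h1 i) (h3 i), t.apply_apply, hx]
    rw [t.apply_apply, t.apply_apply, hx, hva]
  · exact star_polarPart_mul_self (h1 i) (hxa i) (h3 i)
  · exact polarPart_mul_star_self (h1 i) (h2 i) (hxa i) (hxb i) (h3 i) (h4 i)

end IsIdealTower

variable {ι : Type} [Finite ι] {φ : NCFun.{u} ι} {h : φ.NullBounded}

/-- Solutions of the relations of a semiprojective C*-algebra lift along towers. -/
theorem Semiprojective.exists_lift (hA : Semiprojective (UniversalCStar φ h)) {B C : Type u}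
    [CStarAlgebra B] [CStarAlgebra C] {J : ℕ → TwoSidedIdeal B} {Q : ℕ → Type u}
    [∀ n, CStarAlgebra (Q n)] {q : ∀ n, B →⋆ₐ[ℂ] Q n} {qC : B →⋆ₐ[ℂ] C} {r : ∀ n, Q n →⋆ₐ[ℂ] C}
    (t : IsIdealTower J q qC r) (hJ : ∀ n, IsClosed (J n : Set B)) {T : ι → C}
    (hT : φ.eval T = 0) :
    ∃ b : ι → B, (∀ i, qC (b i) = T i) ∧ ∀ᶠ n in atTop, φ.eval (fun i => q n (b i)) = 0 := by
  obtain ⟨N, f, hf⟩ := hA B J t.mono hJ Q C q qC r t.isQuotientHom t.isQuotientHom_limit t.comp_eq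
    (UniversalCStar.lift h hT)
  -- The solution in `Q N` is pulled back to `B`, so that one tuple represents it at all later
  -- levels and separate lifts can be compared at a common one.
  choose b hb using fun i => (t.isQuotientHom N).1 (f (UniversalCStar.gen φ h i))
  refine ⟨b, fun i => ?_, t.eventually_eval_eq_zero φ (m := N) ?_⟩
  · rw [← t.apply_apply N, hb, ← UniversalCStar.lift_gen h hT i, hf]; rfl
  · simp_rw [hb]; exact UniversalCStar.eval_map_gen h f

/-- A homomorphism out of the universal algebra is determined by a solution tuple, so it is enough
to lift tuples. -/
theorem semiprojective_of_exists_lift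
    (H : ∀ (B C : Type u) [CStarAlgebra B] [CStarAlgebra C] (J : ℕ → TwoSidedIdeal B)
      (Q : ℕ → Type u) [∀ n, CStarAlgebra (Q n)] (q : ∀ n, B →⋆ₐ[ℂ] Q n) (qC : B →⋆ₐ[ℂ] C)
      (r : ∀ n, Q n →⋆ₐ[ℂ] C), IsIdealTower J q qC r → (∀ n, IsClosed (J n : Set B)) →
      ∀ T : ι → C, φ.eval T = 0 →
      ∃ (N : ℕ) (S : ι → Q N), φ.eval S = 0 ∧ ∀ i, r N (S i) = T i) :
    Semiprojective (UniversalCStar φ h) := by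
  intro B _ J hJ hJc Q _ C _ q qC r h1 h2 h3 π
  obtain ⟨N, S, hS, hST⟩ := H B C J Q q qC r ⟨hJ, h1, h2, h3⟩ hJc _
    (UniversalCStar.eval_map_gen h π)
  refine ⟨N, UniversalCStar.lift h hS, UniversalCStar.hom_ext h fun i => ?_⟩
  rw [StarAlgHom.comp_apply, UniversalCStar.lift_gen, hST]

/-- Supports and ranges may be lifted independently: `exists_partialIsometry_lift` accepts any
lifted projections whose images are the supports and ranges of `v`. -/
theorem Semiprojective.glue {n : ℕ} {φ ψ : NCFun.{u} (Fin n)} {hφ : φ.NullBounded}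
    {hψ : ψ.NullBounded} (hP : ∀ i, IsStarProjection (UniversalCStar.gen φ hφ i))
    (hQ : ∀ i, IsStarProjection (UniversalCStar.gen ψ hψ i))
    (sφ : Semiprojective (UniversalCStar φ hφ)) (sψ : Semiprojective (UniversalCStar ψ hψ))
    (hΦ : (NCFun.glue φ ψ).NullBounded) :
    Semiprojective (UniversalCStar (NCFun.glue φ ψ) hΦ) := by
  refine semiprojective_of_exists_lift fun B C _ _ J Q _ q qC r t hJ v hv => ?_
  rw [NCFun.glue_eval_eq_zero_iff] at hv
  obtain ⟨a, ha, ha'⟩ := sφ.exists_lift t hJ hv.1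
  obtain ⟨b, hb, hb'⟩ := sψ.exists_lift t hJ hv.2
  have pa := ha'.mono fun _ => UniversalCStar.isStarProjection_of_eval_eq_zero hφ hP
  have pb := hb'.mono fun _ => UniversalCStar.isStarProjection_of_eval_eq_zero hψ hQ
  obtain ⟨N, h1, h2, V, hV, hVa, hVb⟩ := (ha'.and (hb'.and (t.exists_partialIsometry_lift pa pb
    (fun i => (ha i).symm) fun i => (hb i).symm))).exists
  refine ⟨N, V, ?_, hV⟩
  rw [NCFun.glue_eval_eq_zero_iff, funext hVa, funext hVb]
  exact ⟨h1, h2⟩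

/-- One relation couples supports and ranges, so they are lifted together as a single tuple indexed
by `Fin n ⊕ Fin n`. -/
theorem Semiprojective.glueJoint {n : ℕ} {φ : NCFun.{u} (Fin n ⊕ Fin n)} {hφ : φ.NullBounded}
    (hP : ∀ i, IsStarProjection (UniversalCStar.gen φ hφ i))
    (sφ : Semiprojective (UniversalCStar φ hφ)) (hΨ : (NCFun.glueJoint φ).NullBounded) :
    Semiprojective (UniversalCStar (NCFun.glueJoint φ) hΨ) := by
  refine semiprojective_of_exists_lift fun B C _ _ J Q _ q qC r t hJ v hv => ?_
  rw [NCFun.glueJoint_eval_eq_zero_iff] at hv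
  obtain ⟨a, ha, ha'⟩ := sφ.exists_lift t hJ hv
  have pa := ha'.mono fun _ => UniversalCStar.isStarProjection_of_eval_eq_zero hφ hP
  obtain ⟨N, h1, V, hV, hVa, hVb⟩ := (ha'.and (t.exists_partialIsometry_lift
    (pa.mono fun _ h i => h (Sum.inl i)) (pa.mono fun _ h i => h (Sum.inr i))
    (fun i => (ha (Sum.inl i)).symm) fun i => (ha (Sum.inr i)).symm)).exists
  refine ⟨N, V, ?_, hV⟩
  rw [NCFun.glueJoint_eval_eq_zero_iff, funext hVa, funext hVb]
  convert h1 using 2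
  funext i
  rcases i with i | i <;> rfl

end Semiprojective

/-! ### Lifting to bounded sequences: weak semiprojectivity. -/

section WeaklySemiprojective

theorem mem_boundedSeq_of_eventually {B : ℕ → Type u} [∀ n, CStarAlgebra (B n)] {x : ∀ n, B n}
    {c : ℝ} (hx : ∀ᶠ n in atTop, ‖x n‖ ≤ c) : x ∈ boundedSeq B :=
  IsBoundedUnder.bddAbove_range (f := fun n => ‖x n‖) ⟨c, eventually_map.2 hx⟩

namespace IsSeqQuotientHom

variable {B : ℕ → Type u} [∀ n, CStarAlgebra (B n)] {C : Type u} [CStarAlgebra C]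
  {q : boundedSeq B →⋆ₐ[ℂ] C}

theorem apply_eq_iff (hq : IsSeqQuotientHom q) {x y : boundedSeq B} :
    q x = q y ↔ Tendsto (fun n => ‖x.1 n - y.1 n‖) atTop (𝓝 0) := by
  rw [← sub_eq_zero, ← map_sub, hq.2]
  rfl

theorem apply_eq_of_eventuallyEq (hq : IsSeqQuotientHom q) {x y : boundedSeq B}
    (hxy : ∀ᶠ n in atTop, x.1 n = y.1 n) : q x = q y := by
  refine hq.apply_eq_iff.2 (tendsto_const_nhds.congr' ?_)
  filter_upwards [hxy] with n hn
  rw [hn, sub_self, norm_zero]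

/-- Partial isometries whose support and range projections lift to sequences lift with them. -/
theorem exists_partialIsometry_lift (hq : IsSeqQuotientHom q) {ι : Type} [Finite ι]
    {a b : ι → boundedSeq B} (ha : ∀ᶠ n in atTop, ∀ i, IsStarProjection ((a i).1 n))
    (hb : ∀ᶠ n in atTop, ∀ i, IsStarProjection ((b i).1 n)) {v : ι → C}
    (hva : ∀ i, star (v i) * v i = q (a i)) (hvb : ∀ i, v i * star (v i) = q (b i)) :
    ∃ V : ι → boundedSeq B, (∀ i, q (V i) = v i) ∧
      ∀ᶠ n in atTop, (∀ i, star ((V i).1 n) * (V i).1 n = (a i).1 n) ∧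
        ∀ i, (V i).1 n * star ((V i).1 n) = (b i).1 n := by
  choose w hw using fun i => hq.1 (v i)
  -- The images are idempotent because finitely many terms do not affect the class of a sequence.
  -- Self-adjointness comes from the form `star v * v` or `v * star v`.
  have proj : ∀ c : ι → boundedSeq B, (∀ᶠ n in atTop, ∀ i, IsStarProjection ((c i).1 n)) →
      (∀ i, IsSelfAdjoint (q (c i))) → ∀ i, IsStarProjection (q (c i)) := fun c hc hs i => by
    refine ⟨?_, hs i⟩
    change q (c i) * q (c i) = q (c i)
    rw [← map_mul]
    exact hq.apply_eq_of_eventuallyEq (hc.mono fun n h => (h i).isIdempotentElem)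
  have hva' : ∀ i, v i * q (a i) = v i := fun i => mul_eq_self_of_star_mul_self
    (proj a ha (fun i => hva i ▸ IsSelfAdjoint.star_mul_self _) i) (hva i)
  have hvb' : ∀ i, q (b i) * v i = v i := fun i => mul_eq_self_of_mul_star_self
    (proj b hb (fun i => hvb i ▸ IsSelfAdjoint.mul_star_self _) i) (hvb i)
  let x : ι → boundedSeq B := fun i => b i * w i * a i
  have hx : ∀ i, q (x i) = v i := fun i => by
    simp only [x, map_mul, hw, hvb', hva']
  have t1 : ∀ i, Tendsto (fun n => ‖star ((x i).1 n) * (x i).1 n - (a i).1 n‖) atTop (𝓝 0) :=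
    fun i => (hq.apply_eq_iff (x := star (x i) * x i)).1 (by rw [map_mul, map_star, hx, hva])
  have t2 : ∀ i, Tendsto (fun n => ‖(x i).1 n * star ((x i).1 n) - (b i).1 n‖) atTop (𝓝 0) :=
    fun i => (hq.apply_eq_iff (x := x i * star (x i))).1 (by rw [map_mul, map_star, hx, hvb])
  -- The threshold `1 / 2` is what `norm_polarPart_sub_le` requires, and it is below the `1` needed
  -- for exact supports and ranges.
  have e1 := eventually_all.2 fun i => (t1 i).eventually_le_const (one_half_pos (α := ℝ))
  have e2 := eventually_all.2 fun i => (t2 i).eventually_le_const (one_half_pos (α := ℝ))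
  have hxa : ∀ n, (∀ i, IsStarProjection ((a i).1 n)) → ∀ i,
      (x i).1 n * (a i).1 n = (x i).1 n := fun n hn i => by
    change (b i).1 n * (w i).1 n * (a i).1 n * (a i).1 n = (b i).1 n * (w i).1 n * (a i).1 n
    rw [mul_assoc _ ((a i).1 n), (hn i).isIdempotentElem.eq]
  have hxb : ∀ n, (∀ i, IsStarProjection ((b i).1 n)) → ∀ i,
      (b i).1 n * (x i).1 n = (x i).1 n := fun n hn i => by
    change (b i).1 n * ((b i).1 n * (w i).1 n * (a i).1 n) = (b i).1 n * (w i).1 n * (a i).1 n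
    rw [← mul_assoc, ← mul_assoc, (hn i).isIdempotentElem.eq]
  let y : ∀ (_ : ι) n, B n := fun i n => polarPart ((a i).1 n) ((x i).1 n)
  -- The constant `c` bounds the norms of the sequence `x i`. The estimate serves twice: it makes `y
  -- i` bounded and it shows that `y i` and `x i` differ by a null sequence.
  have hyx : ∀ i, ∃ c : ℝ, 0 ≤ c ∧ ∀ᶠ n in atTop, ‖y i n - (x i).1 n‖ ≤
      c * (2 * ‖star ((x i).1 n) * (x i).1 n - (a i).1 n‖) := fun i => by
    obtain ⟨c, hc⟩ := (x i).2
    refine ⟨c, (norm_nonneg _).trans (hc ⟨0, rfl⟩), ?_⟩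
    filter_upwards [ha, e1] with n h1 h2
    exact (norm_polarPart_sub_le (h1 i) (h2 i)).trans
      (mul_le_mul_of_nonneg_right (hc ⟨n, rfl⟩) (by positivity))
  have hy : ∀ i, y i ∈ boundedSeq B := fun i => by
    obtain ⟨c, hc0, hc⟩ := hyx i
    obtain ⟨d, hd⟩ := (x i).2
    refine mem_boundedSeq_of_eventually (c := c + d) ?_
    filter_upwards [hc, e1] with n h1 h2
    have h3 : ‖y i n - (x i).1 n‖ ≤ c := h1.trans (mul_le_of_le_one_right hc0 (by linarith [h2 i]))
    have h4 : ‖(x i).1 n‖ ≤ d := hd ⟨n, rfl⟩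
    calc ‖y i n‖ = ‖(y i n - (x i).1 n) + (x i).1 n‖ := by rw [sub_add_cancel]
      _ ≤ c + d := (norm_add_le _ _).trans (add_le_add h3 h4)
  refine ⟨fun i => ⟨y i, hy i⟩, fun i => ?_, ?_⟩
  · rw [← hx i, hq.apply_eq_iff]
    obtain ⟨c, -, hc⟩ := hyx i
    refine squeeze_zero' (Eventually.of_forall fun _ => norm_nonneg _) hc ?_
    simpa using ((t1 i).const_mul 2).const_mul c
  · filter_upwards [ha, hb, e1, e2] with n h1 h2 h3 h4
    have h3' := fun i => (h3 i).trans_lt one_half_lt_one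
    exact ⟨fun i => star_polarPart_mul_self (h1 i) (hxa n h1 i) (h3' i), fun i =>
      polarPart_mul_star_self (h1 i) (h2 i) (hxa n h1 i) (hxb n h2 i) (h3' i)
        ((h4 i).trans_lt one_half_lt_one)⟩

/-- A sequence of maps that are eventually `*`-homomorphisms defines a `*`-homomorphism into
`∏ n, B n / ⨁ n, B n`. -/
theorem exists_hom (hq : IsSeqQuotientHom q) {A : Type u} [CStarAlgebra A] (ρ : ∀ n, A → B n)
    (hρ : ∀ᶠ n in atTop, ∃ f : A →⋆ₐ[ℂ] B n, ⇑f = ρ n) :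
    ∃ (hb : ∀ a, (fun n => ρ n a) ∈ boundedSeq B) (g : A →⋆ₐ[ℂ] C),
      ∀ a, g a = q ⟨fun n => ρ n a, hb a⟩ := by
  have hb : ∀ a, (fun n => ρ n a) ∈ boundedSeq B := fun a => by
    refine mem_boundedSeq_of_eventually (c := ‖a‖) ?_
    filter_upwards [hρ] with n hn
    obtain ⟨f, hf⟩ := hn
    rw [← hf]
    exact NonUnitalStarAlgHom.norm_apply_le f a
  refine ⟨hb, { toFun := fun a => q ⟨fun n => ρ n a, hb a⟩, map_one' := ?_,
                map_mul' := fun x y => ?_, map_zero' := ?_, map_add' := fun x y => ?_,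
                commutes' := fun c => ?_, map_star' := fun x => ?_ }, fun _ => rfl⟩
  · rw [← map_one q]
    refine hq.apply_eq_of_eventuallyEq (hρ.mono ?_)
    rintro n ⟨f, hf⟩
    change ρ n 1 = 1
    rw [← hf, map_one]
  · rw [← map_mul]
    refine hq.apply_eq_of_eventuallyEq (hρ.mono ?_)
    rintro n ⟨f, hf⟩
    change ρ n (x * y) = ρ n x * ρ n y
    rw [← hf, map_mul]
  · rw [← map_zero q]
    refine hq.apply_eq_of_eventuallyEq (hρ.mono ?_)
    rintro n ⟨f, hf⟩
    change ρ n 0 = 0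
    rw [← hf, map_zero]
  · rw [← map_add]
    refine hq.apply_eq_of_eventuallyEq (hρ.mono ?_)
    rintro n ⟨f, hf⟩
    change ρ n (x + y) = ρ n x + ρ n y
    rw [← hf, map_add]
  · rw [← AlgHomClass.commutes q]
    refine hq.apply_eq_of_eventuallyEq (hρ.mono ?_)
    rintro n ⟨f, hf⟩
    change ρ n (algebraMap ℂ A c) = algebraMap ℂ (B n) c
    rw [← hf, AlgHomClass.commutes]
  · rw [← map_star]
    refine hq.apply_eq_of_eventuallyEq (hρ.mono ?_)
    rintro n ⟨f, hf⟩
    change ρ n (star x) = star (ρ n x)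
    rw [← hf, map_star]

end IsSeqQuotientHom

variable {ι : Type} [Finite ι] {φ : NCFun.{u} ι} {h : φ.NullBounded}

/-- Solutions of the relations of a weakly semiprojective C*-algebra lift to sequences of eventual
solutions. -/
theorem WeaklySemiprojective.exists_lift (hA : WeaklySemiprojective (UniversalCStar φ h))
    {B : ℕ → Type u} [∀ n, CStarAlgebra (B n)] {C : Type u} [CStarAlgebra C]
    {q : boundedSeq B →⋆ₐ[ℂ] C} (hq : IsSeqQuotientHom q) {T : ι → C} (hT : φ.eval T = 0) :
    ∃ S : ι → boundedSeq B, (∀ i, q (S i) = T i) ∧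
      ∀ᶠ n in atTop, φ.eval (fun i => (S i).1 n) = 0 := by
  obtain ⟨ρ, N, hf, hρ⟩ := hA B C q hq (UniversalCStar.lift h hT)
  choose hb hρ using hρ
  refine ⟨fun i => ⟨_, hb (UniversalCStar.gen φ h i)⟩, fun i => ?_, ?_⟩
  · rw [← hρ, UniversalCStar.lift_gen]
  · filter_upwards [eventually_ge_atTop N] with n hn
    obtain ⟨f, hf⟩ := hf n hn
    simp_rw [← hf]
    exact UniversalCStar.eval_map_gen h f

theorem weaklySemiprojective_of_exists_lift
    (H : ∀ (B : ℕ → Type u) [∀ n, CStarAlgebra (B n)] (C : Type u) [CStarAlgebra C]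
      (q : boundedSeq B →⋆ₐ[ℂ] C), IsSeqQuotientHom q → ∀ T : ι → C, φ.eval T = 0 →
      ∃ S : ι → boundedSeq B, (∀ i, q (S i) = T i) ∧
        ∀ᶠ n in atTop, φ.eval (fun i => (S i).1 n) = 0) :
    WeaklySemiprojective (UniversalCStar φ h) := by
  classical
  intro B _ C _ q hq π
  obtain ⟨S, hS, hS0⟩ := H B C q hq _ (UniversalCStar.eval_map_gen h π)
  obtain ⟨N, hN⟩ := eventually_atTop.1 hS0
  -- Below `N` there need be no unital `*`-homomorphism into `B n`. The zero map serves there as an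
  -- arbitrary function.
  let ρ : ∀ n, UniversalCStar φ h → B n := fun n =>
    if hn : N ≤ n then UniversalCStar.lift h (hN n hn) else 0
  have hρ : ∀ n (hn : N ≤ n), ρ n = UniversalCStar.lift h (hN n hn) := fun n hn => dif_pos hn
  have hρ' : ∀ n, N ≤ n → ∃ f : UniversalCStar φ h →⋆ₐ[ℂ] B n, ⇑f = ρ n := fun n hn =>
    ⟨_, (hρ n hn).symm⟩
  obtain ⟨hb, g, hg⟩ := hq.exists_hom ρ ((eventually_ge_atTop N).mono hρ')
  -- Both sides are homomorphisms, so it suffices to compare them on the generators, where the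
  -- sequence given by `ρ` agrees with `S` from `N` on.
  have hπ : π = g := UniversalCStar.hom_ext h fun i => by
    rw [← hS, hg]
    refine hq.apply_eq_of_eventuallyEq ((eventually_ge_atTop N).mono fun n hn => ?_)
    change _ = ρ n _
    rw [hρ n hn, UniversalCStar.lift_gen]
  exact ⟨ρ, N, hρ', fun a => ⟨hb a, by rw [hπ, hg]⟩⟩

theorem WeaklySemiprojective.glue {n : ℕ} {φ ψ : NCFun.{u} (Fin n)} {hφ : φ.NullBounded}
    {hψ : ψ.NullBounded} (hP : ∀ i, IsStarProjection (UniversalCStar.gen φ hφ i))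
    (hQ : ∀ i, IsStarProjection (UniversalCStar.gen ψ hψ i))
    (sφ : WeaklySemiprojective (UniversalCStar φ hφ))
    (sψ : WeaklySemiprojective (UniversalCStar ψ hψ)) (hΦ : (NCFun.glue φ ψ).NullBounded) :
    WeaklySemiprojective (UniversalCStar (NCFun.glue φ ψ) hΦ) := by
  refine weaklySemiprojective_of_exists_lift fun B _ C _ q hq v hv => ?_
  rw [NCFun.glue_eval_eq_zero_iff] at hv
  obtain ⟨a, ha, ha'⟩ := sφ.exists_lift hq hv.1
  obtain ⟨b, hb, hb'⟩ := sψ.exists_lift hq hv.2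
  have pa := ha'.mono fun _ => UniversalCStar.isStarProjection_of_eval_eq_zero hφ hP
  have pb := hb'.mono fun _ => UniversalCStar.isStarProjection_of_eval_eq_zero hψ hQ
  obtain ⟨V, hV, hVab⟩ := hq.exists_partialIsometry_lift pa pb
    (fun i => (ha i).symm) fun i => (hb i).symm
  refine ⟨V, hV, ?_⟩
  filter_upwards [ha', hb', hVab] with m h1 h2 h3
  rw [NCFun.glue_eval_eq_zero_iff, funext h3.1, funext h3.2]
  exact ⟨h1, h2⟩

theorem WeaklySemiprojective.glueJoint {n : ℕ} {φ : NCFun.{u} (Fin n ⊕ Fin n)}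
    {hφ : φ.NullBounded} (hP : ∀ i, IsStarProjection (UniversalCStar.gen φ hφ i))
    (sφ : WeaklySemiprojective (UniversalCStar φ hφ)) (hΨ : (NCFun.glueJoint φ).NullBounded) :
    WeaklySemiprojective (UniversalCStar (NCFun.glueJoint φ) hΨ) := by
  refine weaklySemiprojective_of_exists_lift fun B _ C _ q hq v hv => ?_
  rw [NCFun.glueJoint_eval_eq_zero_iff] at hv
  obtain ⟨a, ha, ha'⟩ := sφ.exists_lift hq hv
  have pa := ha'.mono fun _ => UniversalCStar.isStarProjection_of_eval_eq_zero hφ hP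
  obtain ⟨V, hV, hVab⟩ := hq.exists_partialIsometry_lift
    (pa.mono fun _ h i => h (Sum.inl i)) (pa.mono fun _ h i => h (Sum.inr i))
    (fun i => (ha (Sum.inl i)).symm) fun i => (ha (Sum.inr i)).symm
  refine ⟨V, hV, ?_⟩
  filter_upwards [ha', hVab] with m h1 h2
  rw [NCFun.glueJoint_eval_eq_zero_iff, funext h2.1, funext h2.2]
  -- The supports and ranges, joined by `Sum.elim`, are the two halves of the single lifted tuple
  -- `a`.
  convert h1 using 2
  funext i
  rcases i with i | i <;> rfl

end WeaklySemiprojective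

theorem mainTheorem1 :
    (∀ (n : ℕ) (φ ψ : NCFun.{u} (Fin n)) (hφ : φ.NullBounded) (hψ : ψ.NullBounded),
      (∀ i, IsStarProjection (UniversalCStar.gen φ hφ i)) →
      (∀ i, IsStarProjection (UniversalCStar.gen ψ hψ i)) →
      ∃ hΦ : (NCFun.glue φ ψ).NullBounded,
        (Semiprojective (UniversalCStar φ hφ) → Semiprojective (UniversalCStar ψ hψ) →
          Semiprojective (UniversalCStar (NCFun.glue φ ψ) hΦ)) ∧
        (WeaklySemiprojective (UniversalCStar φ hφ) → WeaklySemiprojective (UniversalCStar ψ hψ) →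
          WeaklySemiprojective (UniversalCStar (NCFun.glue φ ψ) hΦ))) ∧
    (∀ (n : ℕ) (φ : NCFun.{u} (Fin n ⊕ Fin n)) (hφ : φ.NullBounded),
      (∀ i, IsStarProjection (UniversalCStar.gen φ hφ i)) →
      ∃ hΨ : (NCFun.glueJoint φ).NullBounded,
        (Semiprojective (UniversalCStar φ hφ) →
          Semiprojective (UniversalCStar (NCFun.glueJoint φ) hΨ)) ∧
        (WeaklySemiprojective (UniversalCStar φ hφ) →
          WeaklySemiprojective (UniversalCStar (NCFun.glueJoint φ) hΨ))) := by
  refine ⟨fun n φ ψ hφ hψ hP hQ => ⟨hφ.glue ψ, fun sφ sψ => sφ.glue hP hQ sψ _,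
    fun sφ sψ => sφ.glue hP hQ sψ _⟩, fun n φ hφ hP => ⟨hφ.glueJoint, fun sφ => sφ.glueJoint hP _,
    fun sφ => sφ.glueJoint hP _⟩⟩
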